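/- Let $x_1,x_2,x_3,\dots$ and $a_1,a_2,a_3,\dots$ be independent indeterminates. For $r\in\mathbb N$ put $(y\mid a)^r=(y+a_1)(y+a_2)\cdots(y+a_r)$. For $n\in\mathbb N$ and $\alpha\in\mathbb N^n$ put $A_\alpha(x_1,\dots,x_n\mid a)=\det\bigl((x_i\mid a)^{\alpha_j}\bigr)_{1\le i,j\le n}$, and let $\delta=(n-1,n-2,\dots,0)$. For a partition $\lambda$ of length $\ell(\lambda)\le n$, the factorial Schur polynomial is the (exact) quotient $$s_\lambda(x_1,\dots,x_n\mid a)=\frac{A_{\lambda+\delta}(x_1,\dots,x_n\mid a)}{A_\delta(x_1,\dots,x_n\mid a)}\in\mathbb Z[x_1,\dots,x_n,a_1,a_2,\dots].$$ For $r\in\mathbb Z$ let $h_r(x\,\|\,a)\in\mathbb Z[[x_i,a_i\mid i\ge1]]$ be the coefficient of $t^r$ in $$\prod_{i\ge1}(1-tx_i)^{-1}\prod_{j\ge1}(1+ta_j)\in\bigl(\mathbb Z[[x_i,a_i\mid i\ge1]]\bigr)[[t]]$$ (so $h_r(x\,\|\,a)=0$ for $r<0$). Let $\lambda=(\lambda_1,\lambda_2,\dots)$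 be a partition, let $m\ge\ell(\lambda)$ be an integer, and let $s_\lambda(x\,\|\,a)=\det\bigl(h_{\lambda_i-i+j}(x\,\|\,a)\bigr)_{1\le i,j\le m}$. Then $$\lim_{n\to\infty}s_\lambda(x_1,\dots,x_n\mid a)=s_\lambda(x\,\|\,a)$$ in $\mathbb Z[[x_i,a_i\mid i\ge1]]$, where the limit is taken coefficientwise: the coefficient of each monomial on the left is, for all sufficiently large $n$, equal to its coefficient on the right. -/

import Mathlib

open Filter Topology
open scoped MvPowerSeries.WithPiTopology PowerSeries.WithPiTopology

namespace FactorialSchur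

/-! ### Factorial powers, alternants, and their divisibility -/

/-- `(y | a)^r = (y + a₁)(y + a₂)⋯(y + a_r)`. The sequence is indexed from `0` here, so that
`a k` stands for `a_{k+1}`. -/
def factorialPow {R : Type*} [CommRing R] (a : ℕ → R) (y : R) (r : ℕ) : R :=
  ∏ k ∈ Finset.range r, (y + a k)

/-- `A_α(x | a) = det ((x_i | a)^{α_j})_{1 ≤ i, j ≤ n}`. -/
def alternant {R : Type*} [CommRing R] {n : ℕ} (x : Fin n → R) (a : ℕ → R) (α : Fin n → ℕ) : R :=
  (Matrix.of fun i j : Fin n => factorialPow a (x i) (α j)).det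

/-- `δ = (n - 1, n - 2, …, 1, 0)`. -/
def delta (n : ℕ) (j : Fin n) : ℕ := n - 1 - j

/-- The Vandermonde determinant divides every determinant `det (P_j(x_i))`. -/
theorem vandermonde_dvd_det_eval {R : Type*} [CommRing R] {n : ℕ} (x : Fin n → R)
    (P : Fin n → Polynomial R) :
    (Matrix.vandermonde x).det ∣ (Matrix.of fun i j : Fin n => (P j).eval (x i)).det := by
  nontriviality R
  set Q : Polynomial R := ∏ i, (Polynomial.X - Polynomial.C (x i)) with hQ
  have hmon : Q.Monic := Polynomial.monic_prod_X_sub_C x Finset.univ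
  have hdeg : Q.natDegree = n := by
    simp [hQ, Polynomial.natDegree_prod_of_monic _ _ fun i _ => Polynomial.monic_X_sub_C (x i)]
  have key : (Matrix.of fun i j : Fin n => (P j).eval (x i)) =
      Matrix.vandermonde x * Matrix.of fun k j : Fin n => (P j %ₘ Q).coeff k := by
    ext i j
    have hroot : Q.eval (x i) = 0 := by
      rw [hQ, Polynomial.eval_prod]
      exact Finset.prod_eq_zero (Finset.mem_univ i) (by simp)
    have h1 : (P j).eval (x i) = (P j %ₘ Q).eval (x i) := by
      conv_lhs => rw [← Polynomial.modByMonic_add_div (P j) Q]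
      simp [hroot]
    have h2 : (P j %ₘ Q).degree < (n : ℕ) := by
      refine lt_of_lt_of_le (Polynomial.degree_modByMonic_lt _ hmon) ?_
      rw [← hdeg]
      exact Polynomial.degree_le_natDegree
    have h3 : (P j %ₘ Q).eval (x i) =
        ∑ k ∈ Finset.range n, (P j %ₘ Q).coeff k * x i ^ k := by
      rcases Nat.eq_zero_or_pos n with h0 | h0
      · subst h0; exact i.elim0
      by_cases hz : P j %ₘ Q = 0
      · simp [hz]
      · exact Polynomial.eval_eq_sum_range' ((Polynomial.natDegree_lt_iff_degree_lt hz).2 h2) _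
    rw [Matrix.of_apply, h1, h3, Matrix.mul_apply, Finset.sum_range]
    exact Finset.sum_congr rfl fun k _ => by simp [Matrix.vandermonde_apply, mul_comm]
  rw [key, Matrix.det_mul]
  exact Dvd.intro _ rfl

/-- `A_δ(x | a)` is, up to sign, the Vandermonde determinant. -/
theorem alternant_delta {R : Type*} [CommRing R] {n : ℕ} (x : Fin n → R) (a : ℕ → R) :
    alternant x a (delta n) =
      (Equiv.Perm.sign (Fin.revPerm : Equiv.Perm (Fin n)) : ℤ) * (Matrix.vandermonde x).det := by
  nontriviality R
  have h := Matrix.det_eval_matrixOfPolynomials_eq_det_vandermonde x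
    (fun j : Fin n => ∏ k ∈ Finset.range j, (Polynomial.X + Polynomial.C (a k)))
    (fun j => by
      rw [Polynomial.natDegree_prod_of_monic _ _ fun k _ => Polynomial.monic_X_add_C (a k)]
      simp)
    (fun j => Polynomial.monic_prod_of_monic _ _ fun k _ => Polynomial.monic_X_add_C (a k))
  rw [h, ← Matrix.det_permute']
  unfold alternant factorialPow delta
  congr 1
  ext i j
  simp only [Matrix.of_apply, Matrix.submatrix_apply, id, Polynomial.eval_prod,
    Polynomial.eval_add, Polynomial.eval_X, Polynomial.eval_C, Fin.revPerm_apply, Fin.val_rev]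
  congr 2
  omega

/-- `A_δ(x | a)` divides every `A_α(x | a)`, over any commutative ring. -/
theorem alternant_delta_dvd {R : Type*} [CommRing R] {n : ℕ} (x : Fin n → R) (a : ℕ → R)
    (α : Fin n → ℕ) : alternant x a (delta n) ∣ alternant x a α := by
  have h := vandermonde_dvd_det_eval x
    (fun j : Fin n => ∏ k ∈ Finset.range (α j), (Polynomial.X + Polynomial.C (a k)))
  have e : (Matrix.of fun i j : Fin n => ((fun j : Fin n => ∏ k ∈ Finset.range (α j),
      (Polynomial.X + Polynomial.C (a k))) j).eval (x i)).det = alternant x a α := by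
    simp [alternant, factorialPow, Polynomial.eval_prod]
  rw [e] at h
  rw [alternant_delta]
  rcases Int.units_eq_one_or (Equiv.Perm.sign (Fin.revPerm : Equiv.Perm (Fin n))) with hs | hs
  · simpa [hs] using h
  · simpa [hs] using h

/-! ### The factorial Schur polynomials -/

/-- Names of the indeterminates: `Sum.inl i` is `x_{i+1}` and `Sum.inr j` is `a_{j+1}`
for `i, j ∈ ℕ`. -/
abbrev Var : Type := ℕ ⊕ ℕ

/-- The polynomial ring `ℤ[x_1, x_2, …; a_1, a_2, …]`. -/
abbrev Poly : Type := MvPolynomial Var ℤ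

/-- The formal power series ring `ℤ[[x_1, x_2, …; a_1, a_2, …]]`. -/
abbrev Series : Type := MvPowerSeries Var ℤ

/-- The `n` indeterminates `x_1, …, x_n`. -/
noncomputable def polyX (n : ℕ) (i : Fin n) : Poly := MvPolynomial.X (Sum.inl (i : ℕ))

/-- The indeterminates `a_1, a_2, …`. -/
noncomputable def polyA (j : ℕ) : Poly := MvPolynomial.X (Sum.inr j)

/-- The number of nonzero parts of a partition. -/
def length (lam : YoungDiagram) : ℕ := lam.colLen 0

/-- `A_δ(x_1, …, x_n | a)` is not the zero polynomial. -/
theorem alternant_delta_ne_zero (n : ℕ) : alternant (polyX n) polyA (delta n) ≠ 0 := by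
  have hv : (Matrix.vandermonde (polyX n)).det ≠ 0 := by
    rw [Matrix.det_vandermonde_ne_zero_iff]
    intro i j h
    have := MvPolynomial.X_injective (R := ℤ) h
    exact Fin.ext (Sum.inl_injective this)
  rw [alternant_delta]
  rcases Int.units_eq_one_or (Equiv.Perm.sign (Fin.revPerm : Equiv.Perm (Fin n))) with hs | hs
  · simpa [hs] using hv
  · simpa [hs] using hv

/-- The factorial Schur polynomial `s_λ(x_1, …, x_n | a) = A_{λ+δ}(x | a) / A_δ(x | a)`, the exact
quotient in the polynomial ring, for a partition `λ` of length at most `n`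
(`lam.rowLen j` is the part `λ_{j+1}`). It is `0` if `λ` has length larger than `n`. -/
noncomputable def factorialSchur (n : ℕ) (lam : YoungDiagram) : Poly :=
  if length lam ≤ n then
    (alternant_delta_dvd (polyX n) polyA fun j : Fin n => lam.rowLen j + delta n j).choose
  else 0

/-- The factorial Schur polynomial is the quotient of the two alternants. -/
theorem alternant_delta_mul_factorialSchur (n : ℕ) (lam : YoungDiagram) (h : length lam ≤ n) :
    alternant (polyX n) polyA (delta n) * factorialSchur n lam =
      alternant (polyX n) polyA fun j : Fin n => lam.rowLen j + delta n j := by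
  rw [factorialSchur, if_pos h]
  exact (alternant_delta_dvd (polyX n) polyA
    fun j : Fin n => lam.rowLen j + delta n j).choose_spec.symm

/-! ### The limit objects

The ring of power series has the product topology of the discrete topology on `ℤ`: convergence
means that each coefficient is eventually constant. The ring of power series in `t` over it has
the product topology again. -/

/-- `x_{i+1}` as a power series. -/
noncomputable def seriesX (i : ℕ) : Series := MvPowerSeries.X (Sum.inl i)

/-- `a_{j+1}` as a power series. -/
noncomputable def seriesA (j : ℕ) : Series := MvPowerSeries.X (Sum.inr j)

/-- The factor `(1 - t x_{i+1})⁻¹`. -/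
noncomputable def factorX (i : ℕ) : PowerSeries Series :=
  PowerSeries.invOfUnit (1 - PowerSeries.X * PowerSeries.C (seriesX i)) 1

/-- The factor `1 + t a_{j+1}`. -/
noncomputable def factorA (j : ℕ) : PowerSeries Series :=
  1 + PowerSeries.X * PowerSeries.C (seriesA j)

/-- `∏_{i ≥ 1} (1 - t x_i)⁻¹ ∏_{j ≥ 1} (1 + t a_j)`. -/
noncomputable def genSeries : PowerSeries Series := (∏' i, factorX i) * (∏' j, factorA j)

/-- `h_r(x ‖ a)` for `r ∈ ℤ`: the coefficient of `t^r` in `genSeries`, and `0` for `r < 0`. -/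
noncomputable def hSeries (r : ℤ) : Series :=
  if r < 0 then 0 else PowerSeries.coeff r.toNat genSeries

/-- `det (h_{λ_i - i + j}(x ‖ a))_{1 ≤ i, j ≤ m}`. For every `m` that is at least the length of
`λ` this is `s_λ(x ‖ a)`. -/
noncomputable def schurSeries (lam : YoungDiagram) (m : ℕ) : Series :=
  (Matrix.of fun i j : Fin m => hSeries ((lam.rowLen i : ℤ) - (i : ℤ) + (j : ℤ))).det

/-! ### The infinite products converge -/

theorem factorX_mul (i : ℕ) :
    (1 - PowerSeries.X * PowerSeries.C (seriesX i)) * factorX i = 1 :=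
  PowerSeries.mul_invOfUnit _ _ (by simp)

/-- The series in which no coefficient of a monomial dividing `d` occurs. -/
def lowIdeal (d : Var →₀ ℕ) : Ideal (PowerSeries Series) where
  carrier := {h | ∀ r, ∀ e ≤ d, MvPowerSeries.coeff e (PowerSeries.coeff r h) = 0}
  zero_mem' := by intro r e _; simp
  add_mem' := by
    intro f g hf hg r e he
    simp [hf r e he, hg r e he]
  smul_mem' := by
    intro c f hf r e he
    rw [smul_eq_mul, PowerSeries.coeff_mul, map_sum]
    refine Finset.sum_eq_zero fun p _ => ?_
    rw [MvPowerSeries.coeff_mul]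
    refine Finset.sum_eq_zero fun q hq => ?_
    have hle : q.2 ≤ d := le_trans (by
      rw [← Finset.HasAntidiagonal.mem_antidiagonal.1 hq]; exact le_add_self) he
    rw [hf p.2 q.2 hle, mul_zero]

theorem C_X_mem_lowIdeal (d : Var →₀ ℕ) (v : Var) (hv : d v = 0) :
    (PowerSeries.C (MvPowerSeries.X v : Series)) ∈ lowIdeal d := by
  intro r e he
  rw [PowerSeries.coeff_C]
  split_ifs
  · rw [MvPowerSeries.coeff_X, if_neg]
    rintro rfl
    have := he v
    simp [hv] at this
  · simp

/-- A product of factors `f i`, each congruent to `1` modulo its own indeterminate, converges. -/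
theorem multipliable_of_congr (v : ℕ → Var) (hv : Function.Injective v)
    (f : ℕ → PowerSeries Series)
    (hf : ∀ i, f i - 1 ∈ Ideal.span {PowerSeries.C (MvPowerSeries.X (v i) : Series)}) :
    Multipliable f := by
  classical
  have hN : ∀ d : Var →₀ ℕ, ∃ N, ∀ i, N ≤ i → d (v i) = 0 := by
    intro d
    have hfin : (v ⁻¹' (d.support : Set Var)).Finite :=
      d.support.finite_toSet.preimage hv.injOn
    obtain ⟨B, hB⟩ := hfin.bddAbove
    refine ⟨B + 1, fun i hi => ?_⟩
    by_contra h
    have : i ≤ B := hB (by simpa using h)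
    omega
  choose N hN using hN
  refine ⟨fun s e => MvPowerSeries.coeff e
    (PowerSeries.coeff (s ()) (∏ i ∈ Finset.range (N e), f i)), ?_⟩
  unfold HasProd
  rw [SummationFilter.unconditional_filter]
  refine tendsto_pi_nhds.2 fun s => tendsto_pi_nhds.2 fun e => ?_
  refine tendsto_const_nhds.congr' ?_
  filter_upwards [eventually_ge_atTop (Finset.range (N e))] with S hS
  have hmk : ∀ i, N e ≤ i → Ideal.Quotient.mk (lowIdeal e) (f i) = 1 := by
    intro i hi
    rw [← map_one (Ideal.Quotient.mk (lowIdeal e)), Ideal.Quotient.eq]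
    refine (Ideal.span_le.2 ?_) (hf i)
    rintro _ rfl
    exact C_X_mem_lowIdeal e (v i) (hN e i hi)
  have hq : Ideal.Quotient.mk (lowIdeal e) (∏ i ∈ Finset.range (N e), f i) =
      Ideal.Quotient.mk (lowIdeal e) (∏ i ∈ S, f i) := by
    rw [map_prod, map_prod]
    refine Finset.prod_subset hS fun i _ hi => hmk i ?_
    simpa using hi
  have := (Ideal.Quotient.eq.1 hq) (s ()) e le_rfl
  rw [map_sub, map_sub, sub_eq_zero] at this
  rw [this]
  have hs : s = Finsupp.single () (s ()) := by ext; simp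
  conv_rhs => rw [hs]
  rfl

theorem multipliable_factorX : Multipliable factorX := by
  refine multipliable_of_congr Sum.inl Sum.inl_injective _ fun i => ?_
  have h := factorX_mul i
  have : factorX i - 1 =
      (PowerSeries.X * factorX i) * PowerSeries.C (MvPowerSeries.X (Sum.inl i) : Series) := by
    unfold seriesX at h
    linear_combination h
  rw [this]
  exact Ideal.mul_mem_left _ _ (Ideal.subset_span rfl)

theorem multipliable_factorA : Multipliable factorA := by
  refine multipliable_of_congr Sum.inr Sum.inr_injective _ fun j => ?_
  have : factorA j - 1 =
      PowerSeries.X * PowerSeries.C (MvPowerSeries.X (Sum.inr j) : Series) := by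
    unfold factorA seriesA
    ring
  rw [this]
  exact Ideal.mul_mem_left _ _ (Ideal.subset_span rfl)

end FactorialSchur

/-! The core is a Jacobi–Trudi formula at finite `n`. The coefficient of `t^r` in `(1 - t x)⁻¹ ∏_{j
≤ r} (1 + t a_j)` is `(x | a)^r` (`coeff_geomFactor_mul_elemSeries`). Clearing all but the `i`-th
denominator of `finGenSeries` by `coPoly` therefore writes `(x_i | a)^r` as a combination of `n`
consecutive coefficients of `finGenSeries`, with scalars independent of `r` and `a`
(`factorialPow_eq_sum`). So every alternant matrix is a fixed matrix times a matrix of such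
coefficients. For `δ` the latter is unitriangular, hence `A_δ` is the fixed determinant and cancels
from the quotient.

The remaining determinant shrinks to size `m` (`det_intCoeff_reduce`), and `n` then enters only
through its entries: row `i` involves `n` of the `x`'s and a number of `a`'s that grows with `n`.
The entries converge to the `h_r(x ‖ a)`, and the determinant is continuous. -/

namespace FactorialSchur

/-! ### The generating series of the factorial complete symmetric polynomials -/

/-- The geometric series `(1 - t x)⁻¹`. -/
noncomputable def geomFactor {R : Type*} [CommRing R] (x : R) : PowerSeries R :=
  PowerSeries.invOfUnit (1 - PowerSeries.X * PowerSeries.C x) 1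

theorem mul_geomFactor {R : Type*} [CommRing R] (x : R) :
    (1 - PowerSeries.X * PowerSeries.C x) * geomFactor x = 1 :=
  PowerSeries.mul_invOfUnit _ _ (by simp)

theorem coeff_geomFactor {R : Type*} [CommRing R] (x : R) (k : ℕ) :
    PowerSeries.coeff k (geomFactor x) = x ^ k := by
  induction k with
  | zero => simp [geomFactor]
  | succ k ih =>
    have h : geomFactor x = 1 + PowerSeries.X * (PowerSeries.C x * geomFactor x) := by
      linear_combination mul_geomFactor x
    rw [h, map_add, PowerSeries.coeff_succ_X_mul, PowerSeries.coeff_C_mul, ih, pow_succ',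
      PowerSeries.coeff_one, if_neg (Nat.succ_ne_zero k), zero_add]

/-- The polynomial `∏_{j ≤ r} (1 + t a_j)` as a power series. -/
noncomputable def elemSeries {R : Type*} [CommRing R] (a : ℕ → R) (r : ℕ) : PowerSeries R :=
  ∏ j ∈ Finset.range r, (1 + PowerSeries.X * PowerSeries.C (a j))

/-- From degree `r` on, the coefficients of `(1 - t x)⁻¹ ∏_{j ≤ r} (1 + t a_j)` are the
factorial power `(x | a)^r` times powers of `x`. -/
theorem coeff_geomFactor_mul_elemSeries {R : Type*} [CommRing R] (a : ℕ → R) (x : R) (r s : ℕ) :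
    PowerSeries.coeff (r + s) (geomFactor x * elemSeries a r) = x ^ s * factorialPow a x r := by
  induction r generalizing s with
  | zero => simp [elemSeries, factorialPow, coeff_geomFactor]
  | succ r ih =>
    have h : geomFactor x * elemSeries a (r + 1) = geomFactor x * elemSeries a r +
        PowerSeries.X * (PowerSeries.C (a r) * (geomFactor x * elemSeries a r)) := by
      rw [elemSeries, Finset.prod_range_succ, ← elemSeries]
      ring
    -- The new factor adds `a r` times the preceding coefficient: `x ^ (s + 1) + a r * x ^ s = x ^ s
    -- * (x + a r)`. This is why `s` is generalized.
    have h1 := ih (s + 1)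
    have h2 : r + 1 + s = r + s + 1 := by omega
    rw [← add_assoc] at h1
    rw [h, h2, map_add, PowerSeries.coeff_succ_X_mul, PowerSeries.coeff_C_mul, h1, ih s,
      factorialPow, factorialPow, Finset.prod_range_succ]
    ring

/-- `∏_{i ≤ n} (1 - t x_i)⁻¹ ∏_{j ≤ r} (1 + t a_j)`. -/
noncomputable def finGenSeries {R : Type*} [CommRing R] {n : ℕ} (x : Fin n → R) (a : ℕ → R)
    (r : ℕ) : PowerSeries R :=
  (∏ i, geomFactor (x i)) * elemSeries a r

/-- The coefficient of a power series at an integer, `0` at negative integers. -/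
noncomputable def intCoeff {R : Type*} [CommRing R] (p : ℤ) (f : PowerSeries R) : R :=
  if p < 0 then 0 else PowerSeries.coeff p.toNat f

/-- `∏_{l ≠ i} (1 - t x_l)` as a polynomial. -/
noncomputable def coPoly {R : Type*} [CommRing R] {n : ℕ} (x : Fin n → R) (i : Fin n) :
    Polynomial R :=
  ∏ l ∈ Finset.univ.erase i, (1 - Polynomial.X * Polynomial.C (x l))

theorem natDegree_coPoly_le {R : Type*} [CommRing R] {n : ℕ} (x : Fin n → R) (i : Fin n) :
    (coPoly x i).natDegree ≤ n - 1 := by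
  refine (Polynomial.natDegree_prod_le _ _).trans ?_
  refine (Finset.sum_le_card_nsmul _ _ 1 fun l _ => ?_).trans (by simp)
  compute_degree

theorem coPoly_mul_finGenSeries {R : Type*} [CommRing R] {n : ℕ} (x : Fin n → R) (a : ℕ → R)
    (r : ℕ) (i : Fin n) :
    (coPoly x i : PowerSeries R) * finGenSeries x a r = geomFactor (x i) * elemSeries a r := by
  have h : (coPoly x i : PowerSeries R) * ∏ l ∈ Finset.univ.erase i, geomFactor (x l) = 1 := by
    rw [coPoly, ← Polynomial.coeToPowerSeries.ringHom_apply, map_prod, ← Finset.prod_mul_distrib]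
    refine Finset.prod_eq_one fun l _ => ?_
    simpa [mul_comm PowerSeries.X] using mul_geomFactor (x l)
  rw [finGenSeries, ← Finset.mul_prod_erase _ _ (Finset.mem_univ i)]
  linear_combination geomFactor (x i) * elemSeries a r * h

/-- The factorial powers of `x_i` expand in the integer coefficients of the generating series. -/
theorem factorialPow_eq_sum {R : Type*} [CommRing R] {n : ℕ} (x : Fin n → R) (a : ℕ → R)
    (r : ℕ) (i : Fin n) :
    factorialPow a (x i) r = ∑ k : Fin n, (coPoly x i).coeff (n - 1 - k) *
      intCoeff ((r : ℤ) - (n - 1) + k) (finGenSeries x a r) := by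
  have h := coeff_geomFactor_mul_elemSeries a (x i) r 0
  rw [pow_zero, one_mul, add_zero, ← coPoly_mul_finGenSeries, PowerSeries.coeff_mul,
    Finset.Nat.sum_antidiagonal_eq_sum_range_succ_mk] at h
  have hn : 0 < n := i.pos
  -- `F k` vanishes for `k > r` (negative index) and for `k ≥ n` (degree of `coPoly`), so the sums
  -- over `range (r + 1)` and `range n` agree whichever is longer.
  set F : ℕ → R := fun k => (coPoly x i).coeff k *
    intCoeff ((r : ℤ) - k) (finGenSeries x a r) with hF
  have h1 : factorialPow a (x i) r = ∑ k ∈ Finset.range (r + 1), F k := by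
    rw [← h]
    refine Finset.sum_congr rfl fun k hk => ?_
    have hk' : k ≤ r := by simpa [Nat.lt_succ_iff] using hk
    have h3 : ((r : ℤ) - k).toNat = r - k := by omega
    simp only [hF, intCoeff, Polynomial.coeff_coe]
    rw [if_neg (by omega), h3]
  have h2 : ∑ k ∈ Finset.range (r + 1), F k = ∑ k ∈ Finset.range (r + 1 + n), F k := by
    refine Finset.sum_subset (Finset.range_mono (by omega)) fun k _ hk => ?_
    have hk' : r < k := by simpa using hk
    simp only [hF, intCoeff]
    rw [if_pos (by omega), mul_zero]
  have h3 : ∑ k ∈ Finset.range n, F k = ∑ k ∈ Finset.range (r + 1 + n), F k := by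
    refine Finset.sum_subset (Finset.range_mono (by omega)) fun k _ hk => ?_
    have hk' : n ≤ k := by simpa using hk
    have := natDegree_coPoly_le x i
    simp only [hF]
    rw [Polynomial.coeff_eq_zero_of_natDegree_lt (by omega), zero_mul]
  rw [h1, h2, ← h3, ← Finset.sum_range_reflect, Finset.sum_range]
  refine Finset.sum_congr rfl fun k _ => ?_
  have hk := k.isLt
  simp only [hF]
  congr 2
  omega

/-! ### The Jacobi–Trudi identity -/

/-- Every alternant is `det (h_{α_j - (n - 1) + k})` times a determinant independent of `α`. -/
theorem alternant_eq_mul_det {R : Type*} [CommRing R] {n : ℕ} (x : Fin n → R) (a : ℕ → R)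
    (α : Fin n → ℕ) :
    alternant x a α = (Matrix.of fun i k : Fin n => (coPoly x i).coeff (n - 1 - k)).det *
      (Matrix.of fun j k : Fin n =>
        intCoeff ((α j : ℤ) - (n - 1) + k) (finGenSeries x a (α j))).det := by
  rw [← Matrix.det_transpose (Matrix.of fun j k : Fin n =>
        intCoeff ((α j : ℤ) - (n - 1) + k) (finGenSeries x a (α j))), ← Matrix.det_mul, alternant]
  congr 1
  ext i j
  rw [Matrix.mul_apply]
  exact factorialPow_eq_sum x a (α j) i

theorem intCoeff_zero_finGenSeries {R : Type*} [CommRing R] {n : ℕ} (x : Fin n → R) (a : ℕ → R)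
    (r : ℕ) : intCoeff 0 (finGenSeries x a r) = 1 := by
  simp [intCoeff, finGenSeries, elemSeries, geomFactor]

/-- `det (h_{k - j})` is unitriangular. -/
theorem det_intCoeff_sub {R : Type*} [CommRing R] {n k : ℕ} (x : Fin n → R) (a : ℕ → R)
    (r : Fin k → ℕ) :
    (Matrix.of fun i j : Fin k => intCoeff ((j : ℤ) - i) (finGenSeries x a (r i))).det = 1 := by
  -- Below the diagonal the index is negative and on it the coefficient is 1, whatever truncation
  -- each row uses.
  rw [Matrix.det_of_isUpperTriangular]
  · exact Finset.prod_eq_one fun i _ => by simp [intCoeff_zero_finGenSeries]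
  · intro i j hij
    have : (j : ℕ) < i := hij
    rw [Matrix.of_apply, intCoeff, if_pos (by omega)]

/-- The factor independent of `α` is identified by taking `α = δ`, where the other determinant is 1.
No division is needed, so this holds over any commutative ring. -/
theorem alternant_eq_delta_mul_det {R : Type*} [CommRing R] {n : ℕ} (x : Fin n → R) (a : ℕ → R)
    (μ : Fin n → ℕ) :
    alternant x a (fun j => μ j + delta n j) = alternant x a (delta n) *
      (Matrix.of fun i j : Fin n =>
        intCoeff ((μ i : ℤ) - i + j) (finGenSeries x a (μ i + delta n i))).det := by
  rw [alternant_eq_mul_det, alternant_eq_mul_det x a (delta n)]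
  have h1 : (Matrix.of fun j k : Fin n =>
      intCoeff ((delta n j : ℤ) - (n - 1) + k) (finGenSeries x a (delta n j))).det = 1 := by
    rw [← det_intCoeff_sub x a (delta n)]
    congr 2
    funext i j
    congr 1
    have := i.isLt
    simp only [delta]
    omega
  rw [h1, mul_one]
  congr 3
  funext i j
  congr 1
  have := i.isLt
  simp only [delta]
  omega

theorem rowLen_eq_zero (lam : YoungDiagram) {i : ℕ} (h : length lam ≤ i) : lam.rowLen i = 0 := by
  by_contra h0
  have h1 : (i, 0) ∈ lam := YoungDiagram.mem_iff_lt_rowLen.2 (Nat.pos_of_ne_zero h0)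
  have h2 := YoungDiagram.mem_iff_lt_colLen.1 h1
  unfold length at h
  omega

/-- The Jacobi–Trudi determinant of size `n` reduces to one of size `m ≥ ℓ(λ)`. -/
theorem det_intCoeff_reduce {R : Type*} [CommRing R] (lam : YoungDiagram) {m n : ℕ}
    (hm : length lam ≤ m) (hn : m ≤ n) (x : Fin n → R) (a : ℕ → R) (r : ℕ → ℕ) :
    (Matrix.of fun i j : Fin n =>
        intCoeff ((lam.rowLen i : ℤ) - i + j) (finGenSeries x a (r i))).det =
      (Matrix.of fun i j : Fin m =>
        intCoeff ((lam.rowLen i : ℤ) - i + j) (finGenSeries x a (r i))).det := by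
  obtain ⟨k, hk⟩ := Nat.exists_eq_add_of_le hn
  rw [← Matrix.det_submatrix_equiv_self (finSumFinEquiv.trans (finCongr hk.symm)),
    ← Matrix.fromBlocks_toBlocks (Matrix.submatrix _ _ _)]
  -- Rows from `m` on have `λ_i = 0`: their first `m` entries have negative index, and the last
  -- block is unitriangular.
  have h0 : (Matrix.submatrix (Matrix.of fun i j : Fin n =>
      intCoeff ((lam.rowLen i : ℤ) - i + j) (finGenSeries x a (r i)))
      (finSumFinEquiv.trans (finCongr hk.symm))
      (finSumFinEquiv.trans (finCongr hk.symm))).toBlocks₂₁ = 0 := by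
    ext i j
    have hi := rowLen_eq_zero lam (i := m + i) (by omega)
    have hj := j.isLt
    simp only [Matrix.toBlocks₂₁, Matrix.of_apply, Matrix.submatrix_apply, Equiv.trans_apply,
      finSumFinEquiv_apply_left, finSumFinEquiv_apply_right, finCongr_apply, Fin.val_cast,
      Fin.val_natAdd, Fin.val_castAdd, hi, Matrix.zero_apply]
    rw [intCoeff, if_pos (by push_cast; omega)]
  have h1 : (Matrix.submatrix (Matrix.of fun i j : Fin n =>
      intCoeff ((lam.rowLen i : ℤ) - i + j) (finGenSeries x a (r i)))
      (finSumFinEquiv.trans (finCongr hk.symm))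
      (finSumFinEquiv.trans (finCongr hk.symm))).toBlocks₂₂.det = 1 := by
    rw [← det_intCoeff_sub x a fun i : Fin k => r (m + i)]
    congr 1
    ext i j
    have hi := rowLen_eq_zero lam (i := m + i) (by omega)
    simp only [Matrix.toBlocks₂₂, Matrix.of_apply, Matrix.submatrix_apply, Equiv.trans_apply,
      finSumFinEquiv_apply_right, finCongr_apply, Fin.val_cast, Fin.val_natAdd, hi]
    congr 1
    push_cast
    ring
  rw [h0, Matrix.det_fromBlocks_zero₂₁, h1, mul_one]
  rfl

/-! ### The factorial Schur polynomials as power series -/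

theorem map_alternant {R S : Type*} [CommRing R] [CommRing S] (f : R →+* S) {n : ℕ}
    (x : Fin n → R) (a : ℕ → R) (α : Fin n → ℕ) :
    f (alternant x a α) = alternant (fun i => f (x i)) (fun j => f (a j)) α := by
  unfold alternant
  rw [RingHom.map_det]
  congr 1
  ext i j
  simp [factorialPow]

/-- `A_δ` stays nonzero in the power series ring, which is a domain, so it can be cancelled there.
-/
theorem coe_factorialSchur (lam : YoungDiagram) {m n : ℕ} (hm : length lam ≤ m) (hn : m ≤ n) :
    (factorialSchur n lam : Series) = (Matrix.of fun i j : Fin m =>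
      intCoeff ((lam.rowLen i : ℤ) - i + j) (finGenSeries (fun l : Fin n => seriesX l) seriesA
        (lam.rowLen i + (n - 1 - i)))).det := by
  let c : Poly →+* Series := MvPolynomial.coeToMvPowerSeries.ringHom
  have hX : (fun i => c (polyX n i)) = fun l : Fin n => seriesX l := by
    funext i; exact MvPolynomial.coe_X _
  have hA : (fun j => c (polyA j)) = seriesA := by
    funext j; exact MvPolynomial.coe_X _
  have h := congrArg c (alternant_delta_mul_factorialSchur n lam (hm.trans hn))
  have hne : c (alternant (polyX n) polyA (delta n)) ≠ 0 := fun h0 =>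
    alternant_delta_ne_zero n (MvPolynomial.coe_injective _ _ (h0.trans (map_zero c).symm))
  rw [map_mul, map_alternant c _ _ (fun j => _ + _), hX, hA, alternant_eq_delta_mul_det,
    map_alternant c, hX, hA] at h
  rw [map_alternant c, hX, hA] at hne
  have h2 := mul_left_cancel₀ hne h
  exact h2.trans (det_intCoeff_reduce lam hm hn _ _ fun i => lam.rowLen i + (n - 1 - i))

/-! ### The limit -/

/-- The truncation `r` is kept separate from `n` because it differs from row to row. -/
theorem tendsto_finGenSeries {r : ℕ → ℕ} (hr : Tendsto r atTop atTop) :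
    Tendsto (fun n : ℕ => finGenSeries (fun l : Fin n => seriesX l) seriesA (r n)) atTop
      (𝓝 genSeries) := by
  have hX := multipliable_factorX.hasProd.tendsto_prod_nat
  have hA := multipliable_factorA.hasProd.tendsto_prod_nat.comp hr
  refine (hX.mul hA).congr fun n => ?_
  rw [finGenSeries, Fin.prod_univ_eq_prod_range (fun i => geomFactor (seriesX i)) n]
  rfl

theorem continuous_intCoeff (p : ℤ) :
    Continuous (intCoeff p : PowerSeries Series → Series) := by
  unfold intCoeff
  split_ifs
  · exact continuous_const
  · exact PowerSeries.WithPiTopology.continuous_coeff _ _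

end FactorialSchur

theorem mainTheorem6 (lam : YoungDiagram) (m : ℕ) (hm : FactorialSchur.length lam ≤ m) :
    Tendsto
      (fun n : ℕ => ((FactorialSchur.factorialSchur n lam : FactorialSchur.Poly) :
        FactorialSchur.Series))
      atTop (𝓝 (FactorialSchur.schurSeries lam m)) := by
  have hdet : Continuous (Matrix.det : Matrix (Fin m) (Fin m) FactorialSchur.Series → _) :=
    continuous_id.matrix_det
  refine Tendsto.congr' (eventually_atTop.2
    ⟨m, fun n hn => (FactorialSchur.coe_factorialSchur lam hm hn).symm⟩) ?_
  refine (hdet.tendsto _).comp (tendsto_pi_nhds.2 fun i => tendsto_pi_nhds.2 fun j => ?_)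
  refine ((FactorialSchur.continuous_intCoeff _).tendsto _).comp
    (FactorialSchur.tendsto_finGenSeries ?_)
  -- The truncation `λ_i + (n - 1 - i)` is at least `n - (1 + i)`.
  refine tendsto_atTop_mono (fun n => ?_) (tendsto_sub_atTop_nat (1 + (i : ℕ)))
  omega
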